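/- Let $p\ge 2$ and $k\ge 1$, and let $K=T(p,kp+1;2,1)$ be the twisted torus knot obtained from the torus knot $T(p,kp+1)$ by adding one positive full twist on two adjacent strands, i.e. the closure of the positive braid $(\sigma_1\sigma_2\cdots\sigma_{p-1})^{kp+1}\sigma_1^{2}$ on $p$ strands. Let $\Delta_K(t)\in\mathbb Z[t]$ be its Alexander polynomial, a generator of the first elementary ideal of the Alexander matrix of $K$ (obtained by Fox calculus from a Wirtinger presentation of the knot group), which is unique up to units $\pm t^m$ of $\mathbb Z[t,t^{-1}]$ and is normalized to be a polynomial in $t$ with positive constant term. If $p\ge 3$, then \[ \begin{aligned} \Delta_K(t)=1&+\sum_{i=1}^k(-t+t^{p})\,t^{(i-1)p}\\ &+\sum_{i=1}^{p-3}\sum_{j=1}^{k}\bigl(-t^{ikp+1}+t^{ikp+2}-t^{ikp+2+i}+t^{(ik+1)p}\bigr)\,t^{(j-1)p}\\ &+\sum_{i=1}^{k+1}\bigl(-t^{kp(p-2)+1}+t^{kp(p-2)+2}\bigr)\,t^{(i-1)p}, \end{aligned} \] where an empty sum is $0$. If $p=2$, then \[ \Delta_K(t)=1-t+t^2-\dots+t^{2k+2}=\sum_{i=0}^{2k+2}(-t)^i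 . \] -/

import Mathlib

open Polynomial LaurentPolynomial

/-- A letter of a braid word on `n` strands: the elementary braid exchanging the strands in
positions `pos` and `pos + 1` (positions are counted from `0`). If `positive` is `true` this is the
generator `σ` (a positive crossing), otherwise its inverse (a negative crossing). -/
structure BraidLetter (n : ℕ) where
  pos : ℕ
  lt : pos + 1 < n
  positive : Bool

namespace BraidLetter

variable {n : ℕ}

/-- The left one of the two positions that are exchanged. -/
def left (c : BraidLetter n) : Fin n := ⟨c.pos, Nat.lt_of_succ_lt c.lt⟩

/-- The right one of the two positions that are exchanged. -/
def right (c : BraidLetter n) : Fin n := ⟨c.pos + 1, c.lt⟩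

/-- Wirtinger's rule at a crossing. If the strands entering a crossing carry the meridians
`x 0, …, x (n - 1)`, this is the meridian of the strand that leaves in position `k`, as a word in
`x` (a letter `(a, true)` stands for `a` and `(a, false)` for `a⁻¹`).
At a positive crossing the strand from `left` to `right` passes over the other one:
it keeps its meridian `a`, and the meridian `b` of the other strand becomes `a * b * a⁻¹`.
At a negative crossing the strand from `right` to `left` passes over the other one:
it keeps its meridian `b`, and the meridian `a` of the other strand becomes `b⁻¹ * a * b`. -/
def outWord {α : Type} (c : BraidLetter n) (x : Fin n → α) (k : Fin n) : List (α × Bool) :=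
  if k = c.left then
    if c.positive then [(x c.left, true), (x c.right, true), (x c.left, false)]
    else [(x c.right, true)]
  else if k = c.right then
    if c.positive then [(x c.left, true)]
    else [(x c.right, false), (x c.left, true), (x c.right, true)]
  else [(x k, true)]

end BraidLetter

/-- Braid words on `n` strands. A word `w` also stands for the oriented link diagram that is the
closure of the geometric braid `w`, all strands being oriented in the direction of the braid. -/
abbrev BraidWord (n : ℕ) : Type := List (BraidLetter n)

namespace BraidWord

variable {n : ℕ}

/-- The pieces into which the diagram of the closed braid is cut by the levels
`0, 1, …, w.length` between consecutive crossings: `(j, i)` is the piece of strand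
that meets level `j` in position `i`. -/
abbrev Segment (w : BraidWord n) : Type := Fin (w.length + 1) × Fin n

/-- Index set of the Wirtinger relations of the closed braid: one for each strand leaving one of the
crossings, and one for each strand that is closed up. -/
abbrev RelIndex (w : BraidWord n) : Type := (Fin w.length × Fin n) ⊕ Fin n

/-- The Wirtinger relators of the diagram of the closed braid `w`, whose generators are the meridians
of its segments: the segment leaving the `j`-th crossing in position `k` has the meridian given
by Wirtinger's rule, and the last level is identified with the first one. Together they present the
group of the link. -/
def relator (w : BraidWord n) : w.RelIndex → List (w.Segment × Bool)
  | .inl (j, k) =>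
      ((j.succ, k), true) ::
        FreeGroup.invRev ((w.get j).outWord (fun i => (j.castSucc, i)) k)
  | .inr k => [((Fin.last w.length, k), true), ((0, k), false)]

end BraidWord

/-- The Fox derivative `∂w/∂x` of a word `w` in a free group, mapped to `ℤ[t, t⁻¹]` by sending every
generator to `t`. It is determined by `∂(uv)/∂x = ∂u/∂x + u * ∂v/∂x`, `∂x/∂x = 1`,
`∂x⁻¹/∂x = -x⁻¹` and `∂y/∂x = 0` for the other generators `y`. -/
noncomputable def foxDeriv {α : Type} [DecidableEq α] (x : α) : List (α × Bool) → ℤ[T;T⁻¹]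
  | [] => 0
  | (y, true) :: w => (if y = x then 1 else 0) + T 1 * foxDeriv x w
  | (y, false) :: w => (if y = x then -T (-1) else 0) + T (-1) * foxDeriv x w

/-- The `d`-th elementary ideal of a matrix whose columns correspond to generators and whose rows
correspond to relations: the ideal generated by its minors of size (number of columns) `- d`. -/
def elementaryIdeal {R ρ α : Type} [CommRing R] [Fintype α] (A : Matrix ρ α R) (d : ℕ) :
    Ideal R :=
  Ideal.span {a | ∃ (f : Fin (Fintype.card α - d) → ρ) (g : Fin (Fintype.card α - d) → α),
    a = (A.submatrix f g).det}

namespace BraidWord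

variable {n : ℕ}

/-- The Alexander matrix of the Wirtinger presentation of the closed braid `w`. -/
noncomputable def alexanderMatrix (w : BraidWord n) : Matrix w.RelIndex w.Segment ℤ[T;T⁻¹] :=
  Matrix.of fun r x => foxDeriv x (w.relator r)

/-- `Δ` is the Alexander polynomial of the closure of the braid `w`: it generates the first
elementary ideal of the Alexander matrix. This determines `Δ` up to a unit `±tᵐ` of `ℤ[t, t⁻¹]`; the
unit is fixed by requiring that `Δ` is a polynomial in `t` with a positive constant term
(unless `Δ = 0`, which does not occur for knots). -/
def IsAlexanderPolynomial (w : BraidWord n) (Δ : ℤ[X]) : Prop :=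
  elementaryIdeal w.alexanderMatrix 1 = Ideal.span {toLaurent Δ} ∧ (Δ ≠ 0 → 0 < Δ.coeff 0)

/-- The word `(σ₁ σ₂ ⋯ σ_{r-1})^q` in the first `r` of `n` strands. For `r = n` its closure is the
torus link of type `(n, q)`; for `q = r * s` it is `s` positive full twists on the first `r`
strands. -/
def torusWord (n r q : ℕ) (hr : r ≤ n) : BraidWord n :=
  (List.replicate q (List.ofFn fun i : Fin (r - 1) =>
    (⟨i, by have := i.isLt; omega, true⟩ : BraidLetter n))).flatten

/-- The twisted torus link `T(p, q; r, s)` with `r ≤ p` and `s ≥ 0`: the closure of the braid on `p`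
strands of the torus link of type `(p, q)` followed by `s` full twists on `r` adjacent strands. -/
def twistedTorus (p q r s : ℕ) (hr : r ≤ p) : BraidWord p :=
  torusWord p p q le_rfl ++ torusWord p r (r * s) hr

end BraidWord

/-!
The Alexander matrix `A` of a closed braid on `n` strands is square once rows and columns are matched
by `relEquiv`. It kills the vector `1` (the fundamental identity of Fox calculus, as all generators
map to `t`), and it is killed from the left by a vector `u` with entries `±tᵏ`
(`leftKernel_vecMul`), because the product of the meridians of all strands is the same at every
level. Hence all entries of the adjugate of `A`, which up to sign are the minors generating the first
elementary ideal, agree up to units, and this ideal is generated by a single one of them, `d`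
(`elementaryIdeal_one_eq_span_singleton`). For such a matrix a rank one perturbation has determinant
`det (A + z yᵀ) = (u · z) (∑ yᵢ) d` (`det_add_vecMulVec_of_vecMul_eq_zero`). Eliminating the
levels `1, …, N` one obtains, with the Burau matrix `B` of the braid,
`det (B - 1 + 1 yᵀ) = (1 + t + ⋯ + tⁿ⁻¹) (∑ yᵢ) d`, for every `y`
(`det_burau_sub_one_add_vecMulVec`).

The freedom in `y` makes `B` easy to handle: up to terms `1 yᵀ`, the Burau matrix of `σ₁ ⋯ σ_{p-1}` is
`t C` with the cyclic permutation matrix `C`, so that of `(σ₁ ⋯ σ_{p-1})^(kp+1) σ₁²` is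
`a S C` with `a = t^(kp+1)` and `S` the Burau matrix of `σ₁²`
(`exists_burau_twistedTorus_eq`). The matrix `1 - a S C` is cyclic bidiagonal except in two rows, and
its determinant is `1 - aᵖ - (1 - t) (a + t aᵖ⁻¹ - (1 + t) aᵖ)`
(`det_one_sub_smul_twistMatrix_mul_cyclic`). So this equals `(1 + ⋯ + tᵖ⁻¹) (1 - a) d` up to sign, and
summing geometric series shows that the polynomial of the theorem satisfies the same equation
(`alexanderPoly_mul_geom_sum`). Finally, two polynomials with positive constant term that generate the
same ideal of `ℤ[t, t⁻¹]` are equal (`span_toLaurent_eq_iff`).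
-/

/-! ### Adjugates and rank one perturbations of singular matrices -/

namespace Matrix

variable {ι R : Type*} [Fintype ι] [DecidableEq ι] [CommRing R]

/-- The entries of the adjugate are, up to sign, the minors of size one less, for arbitrary
enumerations `f` of the rows and `g` of the columns. -/
theorem adjugate_apply_equiv_zero {m : ℕ} (M : Matrix ι ι R) (f g : Fin (m + 1) ≃ ι) :
    ∃ s : ℤˣ, adjugate M (g 0) (f 0) =
      (s : ℤ) * (M.submatrix (f ∘ Fin.succ) (g ∘ Fin.succ)).det := by
  set X := M.updateRow (f 0) (Pi.single (g 0) 1) with hX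
  have h1 : (X.submatrix f g).det = (M.submatrix (f ∘ Fin.succ) (g ∘ Fin.succ)).det := by
    rw [det_succ_row_zero, Finset.sum_eq_single 0]
    · have : (X.submatrix f g).submatrix Fin.succ (Fin.succAbove 0)
          = M.submatrix (f ∘ Fin.succ) (g ∘ Fin.succ) := by
        ext i j
        simp [hX, updateRow_apply]
      rw [this]
      simp [hX]
    · intro j _ hj
      simp [hX, hj]
    · simp
  refine ⟨Equiv.Perm.sign (g.trans f.symm), ?_⟩
  have h2 : X.submatrix f g = (X.submatrix f f).submatrix id (g.trans f.symm) := by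
    ext i j; simp
  rw [← h1, h2, det_permute', det_submatrix_equiv_self, adjugate_apply, ← mul_assoc]
  rcases Int.units_eq_one_or (Equiv.Perm.sign (g.trans f.symm)) with h | h <;> rw [h] <;> simp [hX]

theorem det_updateRow_eq_sum_adjugate (M : Matrix ι ι R) (r : ι) (y : ι → R) :
    (M.updateRow r y).det = ∑ c, y c * adjugate M c r := by
  have := det_eq_sum_mul_adjugate_row (M.updateRow r y) r
  rw [this]
  refine Finset.sum_congr rfl fun c _ => ?_
  simp [adjugate_apply]

variable [IsDomain R]

/-- If the rows of `M` sum to zero, the columns of the adjugate are constant: replacing a row of `M` by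
`e_c - e_c'` leaves a matrix that still kills the vector `1`. -/
theorem adjugate_apply_eq_of_mulVec_one_eq_zero {M : Matrix ι ι R} (h : M *ᵥ 1 = 0)
    (c c' r : ι) : adjugate M c r = adjugate M c' r := by
  have key : (M.updateRow r (Pi.single c 1 - Pi.single c' 1)).det = 0 := by
    rw [← exists_mulVec_eq_zero_iff]
    refine ⟨1, ?_, ?_⟩
    · intro h0; exact one_ne_zero (congrFun h0 r)
    · rw [updateRow_mulVec, h]
      ext i
      rcases eq_or_ne i r with rfl | hi <;> simp [*, sub_dotProduct]
  rw [det_updateRow_eq_sum_adjugate] at key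
  simpa [sub_mul, Finset.sum_sub_distrib, Pi.single_apply, sub_eq_zero] using key

/-- If `u` is in the left kernel of `M`, the rows of the adjugate are proportional to `u`: replacing a
column of `M` by `u r' • e_r - u r • e_r'` leaves a matrix that is still killed by `u`. -/
theorem adjugate_apply_mul_eq_of_vecMul_eq_zero {M : Matrix ι ι R} {u : ι → R} (hu : u ≠ 0)
    (h : u ᵥ* M = 0) (c r r' : ι) : adjugate M c r * u r' = adjugate M c r' * u r := by
  have key : (Mᵀ.updateRow c (u r' • Pi.single r 1 - u r • Pi.single r' 1)).det = 0 := by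
    rw [← exists_mulVec_eq_zero_iff]
    refine ⟨u, hu, ?_⟩
    rw [updateRow_mulVec, mulVec_transpose, h]
    ext i
    rcases eq_or_ne i c with rfl | hi <;> simp [*, sub_dotProduct, mul_comm]
  rw [det_updateRow_eq_sum_adjugate, ← adjugate_transpose] at key
  simp only [Pi.sub_apply, Pi.smul_apply, smul_eq_mul, transpose_apply, sub_mul,
    Finset.sum_sub_distrib, sub_eq_zero, Pi.single_apply, mul_ite, mul_one, mul_zero, ite_mul,
    zero_mul, Finset.sum_ite_eq', Finset.mem_univ, if_true] at key
  linear_combination key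

/-- The determinant of a rank one perturbation of a matrix with right kernel vector `1` and left kernel
vector `u`, in terms of one entry of the adjugate. -/
theorem det_add_vecMulVec_of_vecMul_eq_zero {M : Matrix ι ι R} {u : ι → R} {r : ι}
    (hr : u r = 1) (h1 : M *ᵥ 1 = 0) (h : u ᵥ* M = 0) (z y : ι → R) (c : ι) :
    (M + vecMulVec z y).det = (u ⬝ᵥ z) * (∑ i, y i) * adjugate M c r := by
  have e1 := det_updateRow_sum (M + vecMulVec z y) r u
  have e2 : (∑ k, u k • (M + vecMulVec z y) k) = (u ⬝ᵥ z) • y := by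
    have e3 : (∑ k, u k • (M + vecMulVec z y) k) = u ᵥ* (M + vecMulVec z y) := by
      ext i; simp [vecMul, dotProduct]
    rw [e3, vecMul_add, h, vecMul_vecMulVec, zero_add]
  -- Row `r`, replaced by the combination of the rows with coefficients `u`, becomes `(u ⬝ᵥ z) • y`;
  -- multiples of `y` can then be removed from the other rows.
  rw [e2, hr, one_smul, det_updateRow_smul] at e1
  have e4 : ((M + vecMulVec z y).updateRow r y).det = (M.updateRow r y).det := by
    refine det_eq_of_forall_row_eq_smul_add_const (Function.update z r 0) r (by simp) ?_
    intro i j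
    rcases eq_or_ne i r with rfl | hi <;> simp [*, vecMulVec_apply]
  rw [← e1, e4, det_updateRow_eq_sum_adjugate, mul_assoc, Finset.sum_mul]
  congr 1
  refine Finset.sum_congr rfl fun i _ => ?_
  rw [adjugate_apply_eq_of_mulVec_one_eq_zero h1 i c]

end Matrix

namespace Matrix

variable {m n R : Type*} [Fintype m] [DecidableEq m] [Fintype n] [DecidableEq n] [CommRing R]

/-- Block elimination by a solution `X` of `A * X + B = 0`; unlike for the Schur complement, `A` need not
be given as an invertible matrix. -/
theorem det_fromBlocks_of_mul_add_eq_zero (A : Matrix m m R) (B : Matrix m n R) (C : Matrix n m R)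
    (D : Matrix n n R) (X : Matrix m n R) (h : A * X + B = 0) :
    (fromBlocks A B C D).det = A.det * (C * X + D).det := by
  have : fromBlocks A B C D * fromBlocks 1 X 0 1 = fromBlocks A 0 C (C * X + D) := by
    rw [fromBlocks_multiply]; simp [h]
  rw [← det_fromBlocks_zero₁₂ A C, ← this, det_mul]
  simp

end Matrix

/-! ### The first elementary ideal of a square matrix -/

theorem exists_equiv_fin_of_injective {m : ℕ} {ρ : Type*} [Fintype ρ]
    (hm : Fintype.card ρ = m + 1) {f : Fin m → ρ} (hf : Function.Injective f) :
    ∃ F : Fin (m + 1) ≃ ρ, F ∘ Fin.succ = f := by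
  classical
  obtain ⟨r, hr⟩ : ∃ r, r ∉ Set.range f := by
    by_contra! h
    have := Fintype.card_le_of_surjective f h
    simp [hm] at this
  have hi : Function.Injective (Fin.cons r f : Fin (m + 1) → ρ) :=
    Fin.cons_injective_iff.2 ⟨hr, hf⟩
  refine ⟨Equiv.ofBijective _ ((Fintype.bijective_iff_injective_and_card _).2 ⟨hi, by simp [hm]⟩), ?_⟩
  ext i; simp

theorem exists_equiv_fin_zero {m : ℕ} {ρ : Type*} [Fintype ρ]
    (hm : Fintype.card ρ = m + 1) (r : ρ) : ∃ F : Fin (m + 1) ≃ ρ, F 0 = r := by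
  classical
  let F := (Fintype.equivFinOfCardEq hm).symm
  exact ⟨F.trans (Equiv.swap (F 0) r), by simp⟩

/-- The first elementary ideal of a square matrix is generated by the entries of its adjugate. Rows and
columns are matched by an arbitrary bijection `e`. -/
theorem elementaryIdeal_one_eq_span_adjugate {R ρ α : Type} [CommRing R] [Fintype α] [Fintype ρ]
    [DecidableEq ρ] (A : Matrix ρ α R) (e : ρ ≃ α) [Nonempty α] :
    elementaryIdeal A 1 =
      Ideal.span {a | ∃ c r, a = Matrix.adjugate (A.submatrix id e) c r} := by
  obtain ⟨m, hm⟩ : ∃ m, Fintype.card α = m + 1 := Nat.exists_eq_succ_of_ne_zero Fintype.card_ne_zero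
  have hm' : Fintype.card ρ = m + 1 := (Fintype.card_congr e).trans hm
  have hsub : Fintype.card α - 1 = m := by omega
  rw [elementaryIdeal, hsub]
  apply le_antisymm
  -- A minor with a repeated row or column vanishes, the others are entries of the adjugate.
  · rw [Ideal.span_le]
    rintro _ ⟨f, g, rfl⟩
    by_cases hf : Function.Injective f
    · by_cases hg : Function.Injective g
      · obtain ⟨F, rfl⟩ := exists_equiv_fin_of_injective hm' hf
        obtain ⟨G, rfl⟩ := exists_equiv_fin_of_injective hm hg
        obtain ⟨s, hs⟩ := Matrix.adjugate_apply_equiv_zero (A.submatrix id e) F (G.trans e.symm)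
        have hs' : (A.submatrix (F ∘ Fin.succ) (G ∘ Fin.succ)).det = (s : ℤ) *
            Matrix.adjugate (A.submatrix id e) ((G.trans e.symm) 0) (F 0) := by
          rw [hs, ← mul_assoc]
          have : (A.submatrix id e).submatrix (F ∘ Fin.succ) ((G.trans e.symm) ∘ Fin.succ)
            = A.submatrix (F ∘ Fin.succ) (G ∘ Fin.succ) := by ext i j; simp
          rw [this]
          rcases Int.units_eq_one_or s with h | h <;> simp [h]
        rw [hs']
        exact Ideal.mul_mem_left _ _ (Ideal.subset_span ⟨_, _, rfl⟩)
      · obtain ⟨i, j, hij, hne⟩ : ∃ i j, g i = g j ∧ i ≠ j := by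
          simpa [Function.Injective] using hg
        rw [Matrix.det_zero_of_column_eq hne (by intro k; simp [hij])]
        exact Ideal.zero_mem _
    · obtain ⟨i, j, hij, hne⟩ : ∃ i j, f i = f j ∧ i ≠ j := by
        simpa [Function.Injective] using hf
      rw [Matrix.det_zero_of_row_eq hne (by ext k; simp [hij])]
      exact Ideal.zero_mem _
  · rw [Ideal.span_le]
    rintro _ ⟨c, r, rfl⟩
    obtain ⟨F, rfl⟩ := exists_equiv_fin_zero hm' r
    obtain ⟨G, rfl⟩ := exists_equiv_fin_zero hm' c
    obtain ⟨s, hs⟩ := Matrix.adjugate_apply_equiv_zero (A.submatrix id e) F G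
    rw [hs]
    exact Ideal.mul_mem_left _ _ (Ideal.subset_span ⟨_, e ∘ G ∘ Fin.succ, rfl⟩)

open Matrix in
/-- If the rows of `A` sum to zero and the left kernel contains a vector with an entry `1`, the entries
of the adjugate in the column of that entry all agree and generate the first elementary ideal. -/
theorem elementaryIdeal_one_eq_span_singleton {R ρ α : Type} [CommRing R] [IsDomain R] [Fintype α]
    [Fintype ρ] [DecidableEq ρ] (A : Matrix ρ α R) (e : ρ ≃ α) {u : ρ → R} {c r : ρ}
    (hr : u r = 1) (h1 : A.submatrix id e *ᵥ 1 = 0) (h : u ᵥ* A = 0) :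
    elementaryIdeal A 1 = Ideal.span {Matrix.adjugate (A.submatrix id e) c r} := by
  have : Nonempty α := ⟨e r⟩
  have hu : u ≠ 0 := by rintro rfl; simp at hr
  have h' : u ᵥ* (A.submatrix id e) = 0 := by
    ext j; exact congrFun h (e j)
  rw [elementaryIdeal_one_eq_span_adjugate A e]
  apply le_antisymm
  · rw [Ideal.span_le]
    rintro _ ⟨c', r', rfl⟩
    have := Matrix.adjugate_apply_mul_eq_of_vecMul_eq_zero hu h' c' r' r
    rw [hr, mul_one, Matrix.adjugate_apply_eq_of_mulVec_one_eq_zero h1 c' c r] at this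
    rw [this]
    exact Ideal.mul_mem_right _ _ (Ideal.subset_span rfl)
  · exact Ideal.span_mono (by rintro _ rfl; exact ⟨_, _, rfl⟩)

/-! ### The Alexander matrix of a closed braid and the Burau matrix -/

namespace BraidLetter

variable {n : ℕ}

theorem foxDeriv_invRev_outWord {α : Type} [DecidableEq α] (c : BraidLetter n) (φ : Fin n → α)
    (k : Fin n) (x : α) :
    foxDeriv x (FreeGroup.invRev (c.outWord φ k)) = -T (-1) * foxDeriv x (c.outWord φ k) := by
  have hT : (T 1 : ℤ[T;T⁻¹]) * T (-1) = 1 := by rw [← T_add]; simp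
  rcases c with ⟨i, hi, _ | _⟩ <;> simp only [outWord] <;> split_ifs <;>
    simp only [FreeGroup.invRev, List.map_cons, List.map_nil, List.reverse_cons, List.reverse_nil,
      List.nil_append, List.cons_append, Bool.not_true, Bool.not_false, foxDeriv] <;> grind

/-- The (unreduced) Burau matrix of a letter: row `k` contains the Fox derivatives of the meridian
leaving in position `k` by the meridians entering the crossing. -/
noncomputable def burau (c : BraidLetter n) : Matrix (Fin n) (Fin n) ℤ[T;T⁻¹] :=
  Matrix.of fun k i => foxDeriv i (c.outWord id k)

/-- Fox derivatives of Wirtinger's words whose letters are the segments at level `l`. -/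
theorem foxDeriv_outWord_level {N : ℕ} (c : BraidLetter n) (l : Fin N) (k : Fin n)
    (x : Fin N × Fin n) :
    foxDeriv x (c.outWord (fun i => (l, i)) k) = if x.1 = l then c.burau k x.2 else 0 := by
  obtain ⟨l', i⟩ := x
  rcases c with ⟨p, hi, _ | _⟩ <;> simp only [burau, Matrix.of_apply, outWord] <;> split_ifs <;>
    simp only [foxDeriv, Prod.mk.injEq] <;> grind

theorem burau_mulVec_one (c : BraidLetter n) : c.burau.mulVec 1 = 1 := by
  have hT : (T 1 : ℤ[T;T⁻¹]) * T (-1) = 1 := by rw [← T_add]; simp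
  ext1 k
  rcases c with ⟨p, hi, _ | _⟩ <;> simp only [burau, Matrix.mulVec, dotProduct, Matrix.of_apply,
    outWord] <;> split_ifs <;>
    simp [foxDeriv, Finset.sum_add_distrib, mul_add, hT]

/-- The row vector `(1, t, t², …)` is fixed by the Burau matrix: it consists of the Fox derivatives of the
product of all meridians, which a crossing preserves. -/
theorem vecMul_burau (c : BraidLetter n) :
    Matrix.vecMul (fun k : Fin n => (T 1 : ℤ[T;T⁻¹]) ^ (k : ℕ)) c.burau =
      fun k : Fin n => (T 1 : ℤ[T;T⁻¹]) ^ (k : ℕ) := by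
  have hT : (T 1 : ℤ[T;T⁻¹]) * T (-1) = 1 := by rw [← T_add]; simp
  have hne : c.left ≠ c.right := by simp [left, right]
  ext1 i
  have key : ∀ k, c.burau k i = (if k = i then 1 else 0) +
      (if k = c.left then c.burau c.left i - (if c.left = i then 1 else 0) else 0) +
      (if k = c.right then c.burau c.right i - (if c.right = i then 1 else 0) else 0) := by
    intro k
    by_cases h1 : k = c.left
    · subst h1; simp [hne]
    · by_cases h2 : k = c.right
      · subst h2; simp [hne.symm]
      · rw [if_neg h1, if_neg h2, burau, Matrix.of_apply, outWord, if_neg h1, if_neg h2]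
        rw [foxDeriv, foxDeriv, mul_zero, add_zero, add_zero, add_zero, id]
  simp only [Matrix.vecMul, dotProduct]
  rw [Finset.sum_congr rfl fun k _ => by rw [key k]]
  simp only [mul_add, Finset.sum_add_distrib, mul_ite, mul_one, mul_zero, Finset.sum_ite_eq',
    Finset.mem_univ, if_true]
  have hr : (c.right : ℕ) = c.left + 1 := rfl
  rw [hr, pow_succ]
  rcases c with ⟨p, hi, _ | _⟩ <;>
    simp only [burau, outWord, Matrix.of_apply, hne.symm, if_true, if_false, Bool.false_eq_true,
      foxDeriv, id] <;>
    grind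

end BraidLetter

namespace BraidWord

variable {n : ℕ}

/-- The Burau matrix of a braid word. It acts on column vectors, so the first letter of the word is
the rightmost factor. -/
noncomputable def burau (w : BraidWord n) : Matrix (Fin n) (Fin n) ℤ[T;T⁻¹] :=
  (w.map BraidLetter.burau).reverse.prod

theorem burau_append (w w' : BraidWord n) : burau (w ++ w') = burau w' * burau w := by
  simp [burau]

theorem burau_cons (c : BraidLetter n) (w : BraidWord n) : burau (c :: w) = burau w * c.burau := by
  simp [burau]

@[simp] theorem burau_nil : burau ([] : BraidWord n) = 1 := rfl

theorem burau_mulVec_one (w : BraidWord n) : (burau w).mulVec 1 = 1 := by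
  induction w with
  | nil => simp
  | cons c w ih => rw [burau_cons, ← Matrix.mulVec_mulVec, c.burau_mulVec_one, ih]

theorem burau_take_succ (w : BraidWord n) (j : Fin w.length) :
    burau (w.take (j + 1)) = (w.get j).burau * burau (w.take j) := by
  rw [List.take_succ_eq_append_getElem j.isLt, burau_append, burau_cons]
  simp

theorem alexanderMatrix_inl (w : BraidWord n) (j : Fin w.length) (k : Fin n) (x : w.Segment) :
    w.alexanderMatrix (.inl (j, k)) x =
      (if x = (j.succ, k) then 1 else 0) -
        if x.1 = j.castSucc then (w.get j).burau k x.2 else 0 := by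
  have hT : (T 1 : ℤ[T;T⁻¹]) * T (-1) = 1 := by rw [← T_add]; simp
  simp only [alexanderMatrix, Matrix.of_apply, relator, foxDeriv,
    BraidLetter.foxDeriv_invRev_outWord, BraidLetter.foxDeriv_outWord_level]
  rw [← mul_assoc, mul_neg, hT, neg_one_mul, ← sub_eq_add_neg]
  simp only [eq_comm]

theorem alexanderMatrix_inr (w : BraidWord n) (k : Fin n) (x : w.Segment) :
    w.alexanderMatrix (.inr k) x =
      (if x = (Fin.last _, k) then 1 else 0) - if x = (0, k) then 1 else 0 := by
  have hT : (T 1 : ℤ[T;T⁻¹]) * T (-1) = 1 := by rw [← T_add]; simp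
  simp only [alexanderMatrix, Matrix.of_apply, relator, foxDeriv, mul_zero, add_zero]
  grind

/-- A matching of relations and segments: the relation of the strand leaving the `j`-th crossing in
position `k` belongs to the segment `(j + 1, k)` it expresses, the closing relations to the segments at
level `0`. -/
def relEquiv (w : BraidWord n) : w.RelIndex ≃ w.Segment where
  toFun := Sum.elim (fun x => (x.1.succ, x.2)) (fun k => (0, k))
  invFun x := Fin.cases (motive := fun _ => w.RelIndex) (.inr x.2) (fun j => .inl (j, x.2)) x.1
  left_inv := by rintro (⟨j, k⟩ | k) <;> simp
  right_inv := by
    rintro ⟨j, k⟩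
    refine Fin.cases ?_ (fun j => ?_) j <;> simp

/-- A vector in the left kernel of the Alexander matrix. Its entries express that the product of the
meridians is the same at all levels; the signs make the entry at the first closing relation `1`. -/
noncomputable def leftKernel (w : BraidWord n) : w.RelIndex → ℤ[T;T⁻¹] :=
  Sum.elim (fun x => -T 1 ^ (x.2 : ℕ)) (fun k => T 1 ^ (k : ℕ))

theorem leftKernel_vecMul (w : BraidWord n) : Matrix.vecMul w.leftKernel w.alexanderMatrix = 0 := by
  ext1 x
  obtain ⟨l, i⟩ := x
  have h1 : ∑ j : Fin w.length, (if l = j.succ then (T 1 : ℤ[T;T⁻¹]) ^ (i : ℕ) else 0)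
      + (if l = 0 then T 1 ^ (i : ℕ) else 0) = T 1 ^ (i : ℕ) := by
    have := Fin.sum_univ_succ fun l' => if l = l' then (T 1 : ℤ[T;T⁻¹]) ^ (i : ℕ) else 0
    simp only [Finset.sum_ite_eq, Finset.mem_univ, if_true] at this
    rw [add_comm, ← this]
  have h2 : ∑ j : Fin w.length, (if l = j.castSucc then (T 1 : ℤ[T;T⁻¹]) ^ (i : ℕ) else 0)
      + (if l = Fin.last _ then T 1 ^ (i : ℕ) else 0) = T 1 ^ (i : ℕ) := by
    have := Fin.sum_univ_castSucc fun l' => if l = l' then (T 1 : ℤ[T;T⁻¹]) ^ (i : ℕ) else 0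
    simp only [Finset.sum_ite_eq, Finset.mem_univ, if_true] at this
    exact this.symm
  have h3 : ∀ j : Fin w.length,
      ∑ k : Fin n, T 1 ^ (k : ℕ) * (if l = j.castSucc then (w.get j).burau k i else 0)
      = if l = j.castSucc then (T 1 : ℤ[T;T⁻¹]) ^ (i : ℕ) else 0 := by
    intro j
    split_ifs
    · exact congrFun (w.get j).vecMul_burau i
    · simp
  have h4 : ∀ l' : Fin (w.length + 1),
      ∑ k : Fin n, T 1 ^ (k : ℕ) * (if ((l, i) : w.Segment) = (l', k) then (1 : ℤ[T;T⁻¹]) else 0)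
      = if l = l' then T 1 ^ (i : ℕ) else 0 := by
    intro l'
    by_cases h : l = l' <;> simp [h]
  simp only [Matrix.vecMul, dotProduct, Fintype.sum_sum_type, Fintype.sum_prod_type, leftKernel,
    Sum.elim_inl, Sum.elim_inr, alexanderMatrix_inl, alexanderMatrix_inr, mul_sub, neg_mul,
    Finset.sum_sub_distrib, Finset.sum_neg_distrib, h3, h4, Pi.zero_apply]
  linear_combination h2 - h1

/-- The columns of the Burau matrices of the initial subwords, one at each level, solve the equations
given by the crossings. -/
theorem sum_alexanderMatrix_inl_mul (w : BraidWord n) (j : Fin w.length) (k i : Fin n) :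
    ∑ x : w.Segment, w.alexanderMatrix (.inl (j, k)) x * burau (w.take x.1) x.2 i = 0 := by
  simp only [alexanderMatrix_inl, sub_mul, Finset.sum_sub_distrib, ite_mul, one_mul, zero_mul,
    Finset.sum_ite_eq', Finset.mem_univ, if_true]
  rw [Fintype.sum_prod_type_right]
  simp only [Finset.sum_ite_eq', Finset.mem_univ, if_true, Fin.val_succ, Fin.val_castSucc]
  rw [burau_take_succ, Matrix.mul_apply, sub_self]

theorem sum_alexanderMatrix_inr_mul (w : BraidWord n) (k i : Fin n) :
    ∑ x : w.Segment, w.alexanderMatrix (.inr k) x * burau (w.take x.1) x.2 i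
      = (burau w - 1) k i := by
  simp only [alexanderMatrix_inr, sub_mul, Finset.sum_sub_distrib, ite_mul, one_mul, zero_mul,
    Finset.sum_ite_eq', Finset.mem_univ, if_true]
  simp

theorem sum_segment (w : BraidWord n) (f : w.Segment → ℤ[T;T⁻¹]) :
    ∑ x, f x = ∑ x : Fin w.length × Fin n, f (x.1.succ, x.2) + ∑ k, f (0, k) := by
  rw [← w.relEquiv.sum_comp, Fintype.sum_sum_type]
  rfl

theorem alexanderMatrix_mulVec_one (w : BraidWord n) :
    (w.alexanderMatrix.submatrix id w.relEquiv).mulVec 1 = 0 := by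
  ext1 r
  have h0 : (w.alexanderMatrix.submatrix id w.relEquiv).mulVec 1 r = ∑ x, w.alexanderMatrix r x := by
    simp [Matrix.mulVec, dotProduct, w.relEquiv.sum_comp]
  rw [h0]
  obtain ⟨j, k⟩ | k := r
  · simp only [alexanderMatrix_inl, Finset.sum_sub_distrib, Finset.sum_ite_eq', Finset.mem_univ,
      if_true]
    rw [Fintype.sum_prod_type_right]
    have := congrFun (w.get j).burau_mulVec_one k
    simp only [Matrix.mulVec, dotProduct, Pi.one_apply, mul_one] at this
    simp [this, -List.get_eq_getElem]
  · simp [alexanderMatrix_inr]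

/-- A perturbation of the Alexander matrix in the closing relations and the segments at level `0` has
the same determinant as the corresponding perturbation of `burau w - 1`: the relations at the
crossings express all levels by level `0`, with a unitriangular matrix of coefficients. -/
theorem det_alexanderMatrix_add (w : BraidWord n) (z y : Fin n → ℤ[T;T⁻¹]) :
    (w.alexanderMatrix.submatrix id w.relEquiv +
      Matrix.vecMulVec (Sum.elim 0 z) (Sum.elim 0 y)).det =
      (burau w - 1 + Matrix.vecMulVec z y).det := by
  set M := w.alexanderMatrix.submatrix id w.relEquiv with hM
  have hdec : M + Matrix.vecMulVec (Sum.elim 0 z) (Sum.elim 0 y) =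
      Matrix.fromBlocks M.toBlocks₁₁ M.toBlocks₁₂ M.toBlocks₂₁
        (M.toBlocks₂₂ + Matrix.vecMulVec z y) := by
    ext (r | r) (c | c) <;> simp [Matrix.vecMulVec_apply, Matrix.toBlocks₁₁, Matrix.toBlocks₁₂,
      Matrix.toBlocks₂₁, Matrix.toBlocks₂₂]
  have hL : M.toBlocks₁₁.det = 1 := by
    have hentry : ∀ j k j' k', M.toBlocks₁₁ (j, k) (j', k') =
        (if j' = j ∧ k' = k then 1 else 0) -
          if j'.succ = j.castSucc then (w.get j).burau k k' else 0 := by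
      intro j k j' k'
      simp [Matrix.toBlocks₁₁, hM, relEquiv, alexanderMatrix_inl]
    have htri : M.toBlocks₁₁.BlockTriangular (fun x => OrderDual.toDual x.1) := by
      rintro ⟨j, k⟩ ⟨j', k'⟩ hlt
      have hlt' : j < j' := hlt
      rw [hentry, if_neg, if_neg, sub_zero]
      · simp only [Fin.ext_iff, Fin.val_succ, Fin.val_castSucc]; omega
      · rintro ⟨rfl, -⟩; exact lt_irrefl _ hlt'
    rw [htri.det_fintype]
    refine Finset.prod_eq_one fun l _ => ?_
    have : M.toBlocks₁₁.toSquareBlock (fun x => OrderDual.toDual x.1) l = 1 := by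
      ext1 ⟨⟨j, k⟩, hj⟩ ⟨⟨j', k'⟩, hj'⟩
      have : j' = j := hj'.trans hj.symm
      subst this
      have hne : j'.succ ≠ j'.castSucc := by simp [Fin.ext_iff]
      rw [Matrix.toSquareBlock_def, Matrix.of_apply, hentry, if_neg hne]
      simp [Matrix.one_apply, eq_comm]
    rw [this, Matrix.det_one]
  let X : Matrix (Fin w.length × Fin n) (Fin n) ℤ[T;T⁻¹] :=
    Matrix.of fun x i => burau (w.take (x.1 + 1)) x.2 i
  have hX1 : M.toBlocks₁₁ * X + M.toBlocks₁₂ = 0 := by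
    ext1 ⟨j, k⟩ i
    have h := w.sum_alexanderMatrix_inl_mul j k i
    rw [sum_segment] at h
    rw [Matrix.zero_apply, ← h, Matrix.add_apply, Matrix.mul_apply]
    simp [Matrix.toBlocks₁₁, Matrix.toBlocks₁₂, hM, relEquiv, X, Matrix.one_apply]
  have hX2 : M.toBlocks₂₁ * X + M.toBlocks₂₂ = burau w - 1 := by
    ext1 k i
    have h := w.sum_alexanderMatrix_inr_mul k i
    rw [sum_segment] at h
    rw [← h, Matrix.add_apply, Matrix.mul_apply]
    simp [Matrix.toBlocks₂₁, Matrix.toBlocks₂₂, hM, relEquiv, X, Matrix.one_apply]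
  rw [hdec, Matrix.det_fromBlocks_of_mul_add_eq_zero _ _ _ _ X hX1, hL, one_mul, ← add_assoc, hX2]

end BraidWord

/-! ### The Burau matrix of a twisted torus braid -/

theorem BraidLetter.burau_apply_of_positive {n : ℕ} (i : ℕ) (hi : i + 1 < n) (k l : Fin n) :
    (⟨i, hi, true⟩ : BraidLetter n).burau k l =
      if (k : ℕ) = i then (1 - T 1) * (if (l : ℕ) = i then 1 else 0)
        + T 1 * (if (l : ℕ) = i + 1 then 1 else 0)
      else if (k : ℕ) = i + 1 then (if (l : ℕ) = i then 1 else 0) else if k = l then 1 else 0 := by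
  have hT : (T 1 : ℤ[T;T⁻¹]) * T (-1) = 1 := by rw [← T_add]; simp
  have hL : ∀ x : Fin n, x = (⟨i, hi, true⟩ : BraidLetter n).left ↔ (x : ℕ) = i := by
    intro x; simp [left, Fin.ext_iff]
  have hR : ∀ x : Fin n, x = (⟨i, hi, true⟩ : BraidLetter n).right ↔ (x : ℕ) = i + 1 := by
    intro x; simp [right, Fin.ext_iff]
  simp only [burau, Matrix.of_apply, outWord, hL, hR, if_true, id]
  split_ifs <;> simp only [foxDeriv, eq_comm (b := l), hL, hR] <;> grind

namespace Matrix

/-- The permutation matrix of the cyclic shift: it moves the entry `k + 1` of a column vector to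
position `k`, modulo `p`. -/
def cyclic (R : Type*) [CommRing R] (p : ℕ) : Matrix (Fin p) (Fin p) R :=
  of fun k i => if (i : ℕ) = (k + 1) % p then 1 else 0

variable {R : Type*} [CommRing R] {p : ℕ}

theorem cyclic_pow_apply (j : ℕ) (k i : Fin p) :
    (cyclic R p ^ j) k i = if (i : ℕ) = (k + j) % p then 1 else 0 := by
  have hp : 0 < p := k.pos
  induction j generalizing i with
  | zero => simp [Matrix.one_apply, Fin.ext_iff, Nat.mod_eq_of_lt k.isLt, eq_comm]
  | succ j ih =>
    rw [pow_succ, Matrix.mul_apply, Finset.sum_eq_single ⟨(k + j) % p, Nat.mod_lt _ hp⟩]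
    · rw [ih]; simp [cyclic, add_assoc]
    · intro l _ hl
      rw [ih, if_neg (by simpa [Fin.ext_iff] using hl), zero_mul]
    · simp

theorem cyclic_pow_mul_add_one (k : ℕ) : cyclic R p ^ (k * p + 1) = cyclic R p := by
  have : cyclic R p ^ p = 1 := by
    ext1 k i
    rw [cyclic_pow_apply, Matrix.one_apply]
    simp [Fin.ext_iff, Nat.mod_eq_of_lt k.isLt, eq_comm]
  rw [pow_succ, mul_comm k, pow_mul, this, one_pow, one_mul]

theorem cyclic_mulVec (x : Fin p → R) (k : Fin p) :
    (cyclic R p *ᵥ x) k = x ⟨(k + 1) % p, Nat.mod_lt _ k.pos⟩ := by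
  rw [mulVec, dotProduct, Finset.sum_eq_single ⟨(k + 1) % p, Nat.mod_lt _ k.pos⟩]
  · simp [cyclic]
  · intro l _ hl
    rw [cyclic, of_apply, if_neg (by simpa [Fin.ext_iff] using hl), zero_mul]
  · simp

end Matrix

namespace BraidWord

open Matrix

theorem burau_flatten_replicate {n : ℕ} (w : BraidWord n) (q : ℕ) :
    burau (List.replicate q w).flatten = burau w ^ q := by
  induction q with
  | zero => simp
  | succ q ih => rw [List.replicate_succ, List.flatten_cons, burau_append, ih, pow_succ]

/-- The Burau matrix of `σ₁ ⋯ σₘ`: the first strand passes over the next `m` strands. -/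
theorem burau_ofFn_apply {n : ℕ} (m : ℕ) (hm : m < n) (k i : Fin n) :
    burau (List.ofFn fun j : Fin m => (⟨j, by omega, true⟩ : BraidLetter n)) k i =
      if (k : ℕ) < m then (1 - T 1) * (if (i : ℕ) = 0 then 1 else 0)
          + T 1 * (if (i : ℕ) = k + 1 then 1 else 0)
      else if (k : ℕ) = m then (if (i : ℕ) = 0 then 1 else 0)
      else if (i : ℕ) = k then 1 else 0 := by
  induction m generalizing k i with
  | zero =>
    simp only [List.ofFn_zero, burau_nil, Matrix.one_apply, Fin.ext_iff]
    split_ifs <;> first | rfl | omega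
  | succ m ih =>
    have h0 : ∀ k : Fin n, (k : ℕ) = m ↔ k = ⟨m, by omega⟩ := by simp [Fin.ext_iff]
    have h1 : ∀ k : Fin n, (k : ℕ) = m + 1 ↔ k = ⟨m + 1, by omega⟩ := by simp [Fin.ext_iff]
    have hS := BraidLetter.burau_apply_of_positive m (by omega : m + 1 < n)
    rw [List.ofFn_succ', List.concat_eq_append, burau_append, burau_cons, burau_nil, one_mul,
      Matrix.mul_apply]
    simp only [Fin.val_castSucc, Fin.val_last]
    rw [Finset.sum_congr rfl fun l _ => by rw [hS]]
    by_cases hk : (k : ℕ) = m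
    · simp only [hk, if_true, add_mul, mul_assoc, ite_mul, one_mul, zero_mul,
        Finset.sum_add_distrib, ← Finset.mul_sum]
      simp only [h0, h1, Finset.sum_ite_eq', Finset.mem_univ, if_true]
      rw [ih (by omega), ih (by omega)]
      simp [Fin.ext_iff]
    · by_cases hk1 : (k : ℕ) = m + 1
      · simp only [hk1, if_true, show ¬ m + 1 = m by omega, if_false, ite_mul, one_mul, zero_mul]
        simp only [h0, Finset.sum_ite_eq', Finset.mem_univ, if_true]
        rw [ih (by omega)]
        simp
      · simp only [hk, hk1, if_false, ite_mul, one_mul, zero_mul, Finset.sum_ite_eq,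
          Finset.mem_univ, if_true]
        rw [ih (by omega)]
        have : (k : ℕ) < m + 1 ↔ (k : ℕ) < m := by omega
        simp [hk, this]

/-- Modulo matrices of the form `1 yᵀ`, Burau matrices can be multiplied, as they fix the vector `1`. -/
theorem burau_mul_eq_add_vecMulVec {n : ℕ} {w : BraidWord n} {Y Y' X : Matrix (Fin n) (Fin n) ℤ[T;T⁻¹]}
    (hX : ∃ y, X = Y + vecMulVec 1 y) (hw : ∃ y, burau w = Y' + vecMulVec 1 y) :
    ∃ y, burau w * X = Y' * Y + vecMulVec 1 y := by
  obtain ⟨y, rfl⟩ := hX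
  obtain ⟨y', hy'⟩ := hw
  refine ⟨y' ᵥ* Y + y, ?_⟩
  rw [mul_add, mul_vecMulVec, burau_mulVec_one, hy', add_mul, vecMulVec_mul, vecMulVec_add,
    add_assoc]

theorem exists_burau_torusWord_eq (p q : ℕ) (hp : 2 ≤ p) :
    ∃ y, burau (torusWord p p q le_rfl) =
      ((T 1 : ℤ[T;T⁻¹]) • cyclic ℤ[T;T⁻¹] p) ^ q + vecMulVec 1 y := by
  rw [torusWord, burau_flatten_replicate]
  set w : BraidWord p := List.ofFn fun i : Fin (p - 1) =>
    (⟨i, by have := i.isLt; omega, true⟩ : BraidLetter p)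
  have hw : ∃ y, burau w = (T 1 : ℤ[T;T⁻¹]) • cyclic ℤ[T;T⁻¹] p + vecMulVec 1 y := by
    refine ⟨fun i => (1 - T 1) * if (i : ℕ) = 0 then 1 else 0, ?_⟩
    ext1 k i
    rw [burau_ofFn_apply _ (by omega)]
    simp only [Matrix.add_apply, Matrix.smul_apply, smul_eq_mul, vecMulVec_apply, Pi.one_apply, one_mul, cyclic,
      of_apply]
    by_cases hk : (k : ℕ) < p - 1
    · rw [if_pos hk, Nat.mod_eq_of_lt (by omega), add_comm]
    · have h1 : (k : ℕ) = p - 1 := by omega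
      have h2 : ((k : ℕ) + 1) % p = 0 := by rw [h1, Nat.sub_add_cancel (by omega), Nat.mod_self]
      rw [if_neg hk, if_pos h1, h2]
      ring
  induction q with
  | zero => exact ⟨0, by simp⟩
  | succ q ih =>
    rw [pow_succ', pow_succ']
    exact burau_mul_eq_add_vecMulVec ih hw

/-- The Burau matrix of `σ₁²`, a positive full twist on the first two of `p` strands. -/
noncomputable def twistMatrix (p : ℕ) : Matrix (Fin p) (Fin p) ℤ[T;T⁻¹] :=
  of fun k i =>
    if (k : ℕ) = 0 then (1 - T 1 + T 1 ^ 2) * (if (i : ℕ) = 0 then 1 else 0)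
      + T 1 * (1 - T 1) * (if (i : ℕ) = 1 then 1 else 0)
    else if (k : ℕ) = 1 then (1 - T 1) * (if (i : ℕ) = 0 then 1 else 0)
      + T 1 * (if (i : ℕ) = 1 then 1 else 0)
    else if k = i then 1 else 0

theorem burau_torusWord_two (p : ℕ) (hp : 2 ≤ p) : burau (torusWord p 2 2 hp) = twistMatrix p := by
  have h0 : ∀ k : Fin p, (k : ℕ) = 0 ↔ k = ⟨0, by omega⟩ := by simp [Fin.ext_iff]
  have h1 : ∀ k : Fin p, (k : ℕ) = 1 ↔ k = ⟨1, by omega⟩ := by simp [Fin.ext_iff]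
  have hS := BraidLetter.burau_apply_of_positive 0 (by omega : 0 + 1 < p)
  simp only [zero_add] at hS
  have : torusWord p 2 2 hp = [⟨0, by omega, true⟩, ⟨0, by omega, true⟩] := by
    simp [torusWord, List.replicate_succ]
  rw [this, burau_cons, burau_cons, burau_nil, one_mul]
  ext1 k i
  rw [Matrix.mul_apply, twistMatrix, of_apply, Finset.sum_congr rfl fun l _ => by rw [hS k l]]
  by_cases hk : (k : ℕ) = 0
  · simp only [hk, if_true, add_mul, mul_assoc, ite_mul, one_mul, zero_mul,
      Finset.sum_add_distrib, ← Finset.mul_sum]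
    simp only [h0, h1, Finset.sum_ite_eq', Finset.mem_univ, if_true]
    rw [hS, hS]
    simp only [← h0, ← h1, if_true, one_ne_zero, if_false]
    ring
  · by_cases hk1 : (k : ℕ) = 1
    · simp only [hk1, if_true, ite_mul, one_mul, zero_mul, one_ne_zero, if_false]
      simp only [h0, Finset.sum_ite_eq', Finset.mem_univ, if_true]
      rw [hS]
      simp [Fin.ext_iff]
    · simp only [hk, hk1, if_false, ite_mul, one_mul, zero_mul, Finset.sum_ite_eq,
        Finset.mem_univ, if_true]
      rw [hS]
      simp [hk, hk1]

theorem exists_burau_twistedTorus_eq (p k : ℕ) (hp : 2 ≤ p) :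
    ∃ y, burau (twistedTorus p (k * p + 1) 2 1 hp) =
        (T 1 : ℤ[T;T⁻¹]) ^ (k * p + 1) • (twistMatrix p * cyclic ℤ[T;T⁻¹] p) + vecMulVec 1 y ∧
      ∑ i, y i = 1 - T 1 ^ (k * p + 1) := by
  have h : ∃ y, burau (twistedTorus p (k * p + 1) 2 1 hp) =
      (T 1 : ℤ[T;T⁻¹]) ^ (k * p + 1) • (twistMatrix p * cyclic ℤ[T;T⁻¹] p) + vecMulVec 1 y := by
    rw [twistedTorus, burau_append, ← mul_smul_comm]
    refine burau_mul_eq_add_vecMulVec ?_ ⟨0, by rw [burau_torusWord_two]; simp⟩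
    obtain ⟨y, hy⟩ := exists_burau_torusWord_eq p (k * p + 1) hp
    exact ⟨y, by rw [hy, _root_.smul_pow, cyclic_pow_mul_add_one]⟩
  obtain ⟨y, hy⟩ := h
  refine ⟨y, hy, ?_⟩
  -- All matrices involved fix the vector `1`, which determines the sum of `y`.
  have h1 := burau_mulVec_one (twistedTorus p (k * p + 1) 2 1 hp)
  have hc : cyclic ℤ[T;T⁻¹] p *ᵥ 1 = 1 := by
    ext1 k; rw [cyclic_mulVec]; rfl
  have ht : twistMatrix p *ᵥ 1 = 1 := by
    rw [← burau_torusWord_two p hp, burau_mulVec_one]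
  rw [hy, add_mulVec, smul_mulVec, ← mulVec_mulVec, hc, ht, vecMulVec_mulVec] at h1
  have h2 := congrFun h1 ⟨0, by omega⟩
  simp [dotProduct] at h2
  simp
  linear_combination h2

end BraidWord

/-! ### The determinant of the perturbed Burau matrix -/

namespace BraidWord
open Matrix

theorem det_one_sub_smul_twistMatrix_mul_cyclic (m : ℕ) (a : ℤ[T;T⁻¹]) :
    (1 - a • (twistMatrix (2 + m) * cyclic ℤ[T;T⁻¹] (2 + m))).det =
      1 - a ^ (2 + m) - (1 - T 1) * (a + T 1 * a ^ (1 + m) - (1 + T 1) * a ^ (2 + m)) := by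
  set N := 1 - a • (twistMatrix (2 + m) * cyclic ℤ[T;T⁻¹] (2 + m)) with hN
  let e : Fin m ⊕ Fin 2 ≃ Fin (2 + m) := (Equiv.sumComm _ _).trans finSumFinEquiv
  have e1 : ∀ k, ((e (.inl k) : Fin (2 + m)) : ℕ) = 2 + k := fun k => by simp [e]
  have e2 : ∀ k, ((e (.inr k) : Fin (2 + m)) : ℕ) = k := fun k => by simp [e]
  -- The rows `i ≥ 2` of `N` say `xᵢ = a xᵢ₊₁`, so that `xᵢ = a ^ (2 + m - i) x₀` for `i ≥ 2`; the columns
  -- of `Y` are the solutions with `(x₀, x₁) = (1, 0)` and `(0, 1)`.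
  let Y : Matrix (Fin (2 + m)) (Fin 2) ℤ[T;T⁻¹] := of fun i c =>
    if (i : ℕ) = 0 then (if c = 0 then 1 else 0) else if (i : ℕ) = 1 then (if c = 1 then 1 else 0)
    else if c = 0 then a ^ (2 + m - i) else 0
  have hY0 : ∀ h c, Y ⟨0, h⟩ c = if c = 0 then 1 else 0 := fun h c => by simp [Y]
  have hY1 : ∀ h c, Y ⟨1, h⟩ c = if c = 1 then 1 else 0 := fun h c => by simp [Y]
  have hY2 : ∀ h c, Y ⟨2 % (2 + m), h⟩ c = if c = 0 then a ^ m else 0 := by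
    intro h c
    rcases Nat.eq_zero_or_pos m with rfl | hm
    -- On two strands, `2 % 2 = 0`, and `x₀ = a ^ 0 x₀` fits the same formula.
    · simp [Y]
    · have : 2 % (2 + m) = 2 := Nat.mod_eq_of_lt (by omega)
      simp [Y, this]
  have hNY : ∀ i c, (N * Y) i c = Y i c - a * ∑ l, twistMatrix (2 + m) i l *
      Y ⟨(l + 1) % (2 + m), Nat.mod_lt _ l.pos⟩ c := by
    intro i c
    rw [hN, Matrix.sub_mul, Matrix.one_mul, Matrix.sub_apply, smul_mul, Matrix.smul_apply, smul_eq_mul, Matrix.mul_assoc, Matrix.mul_apply]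
    congr 2
    refine Finset.sum_congr rfl fun l _ => ?_
    rw [← cyclic_mulVec (fun i => Y i c) l]
    rfl
  have h0 : ∀ k : Fin (2 + m), (k : ℕ) = 0 ↔ k = ⟨0, by omega⟩ := fun k => by rw [Fin.ext_iff]
  have h1 : ∀ k : Fin (2 + m), (k : ℕ) = 1 ↔ k = ⟨1, by omega⟩ := fun k => by rw [Fin.ext_iff]
  have hrow0 : ∀ c, (N * Y) (e (.inr 0)) c = (if c = 0 then 1 else 0) -
      a * ((1 - T 1 + T 1 ^ 2) * (if c = 1 then 1 else 0)
        + T 1 * (1 - T 1) * (if c = 0 then a ^ m else 0)) := by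
    intro c
    have : e (.inr 0) = ⟨0, by omega⟩ := Fin.ext (e2 0)
    rw [hNY, this, hY0]
    simp only [twistMatrix, of_apply, if_true, add_mul, mul_assoc, ite_mul, one_mul, zero_mul,
      Finset.sum_add_distrib, ← Finset.mul_sum]
    simp only [h0, h1, Finset.sum_ite_eq', Finset.mem_univ, if_true]
    have h : (0 + 1) % (2 + m) = 1 := Nat.mod_eq_of_lt (by omega)
    simp only [h, hY1, hY2, Nat.reduceAdd]
  have hrow1 : ∀ c, (N * Y) (e (.inr 1)) c = (if c = 1 then 1 else 0) -
      a * ((1 - T 1) * (if c = 1 then 1 else 0)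
        + T 1 * (if c = 0 then a ^ m else 0)) := by
    intro c
    have : e (.inr 1) = ⟨1, by omega⟩ := Fin.ext (e2 1)
    rw [hNY, this, hY1]
    simp only [twistMatrix, of_apply, if_true, one_ne_zero, if_false, add_mul, mul_assoc, ite_mul,
      one_mul, zero_mul, Finset.sum_add_distrib, ← Finset.mul_sum]
    simp only [h0, h1, Finset.sum_ite_eq', Finset.mem_univ, if_true]
    have h : (0 + 1) % (2 + m) = 1 := Nat.mod_eq_of_lt (by omega)
    simp only [h, hY1, hY2, Nat.reduceAdd]
  have hrow2 : ∀ k c, (N * Y) (e (.inl k)) c = 0 := by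
    intro k c
    rw [hNY]
    simp only [twistMatrix, of_apply, e1, show 2 + (k : ℕ) ≠ 0 by omega,
      show 2 + (k : ℕ) ≠ 1 by omega, if_false, ite_mul, one_mul, zero_mul, Finset.sum_ite_eq,
      Finset.mem_univ, if_true, Y]
    have hk := k.isLt
    rcases Nat.lt_or_ge (2 + k + 1) (2 + m) with h | h
    · simp only [Nat.mod_eq_of_lt h, show 2 + (k : ℕ) + 1 ≠ 0 by omega,
        show 2 + (k : ℕ) + 1 ≠ 1 by omega, if_false]
      have : 2 + m - (2 + k) = (2 + m - (2 + k + 1)) + 1 := by omega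
      rw [this]
      split_ifs <;> ring
    · have h' : 2 + (k : ℕ) + 1 = 2 + m := by omega
      rw [h', Nat.mod_self, show 2 + m - (2 + k) = 1 by omega]
      simp
  let M := N.submatrix e e
  have hblocks : M = fromBlocks M.toBlocks₁₁ M.toBlocks₁₂ M.toBlocks₂₁ M.toBlocks₂₂ :=
    (fromBlocks_toBlocks M).symm
  have hsum : ∀ r c, (N * Y) (e r) c = ∑ k, M r (.inl k) * Y (e (.inl k)) c + M r (.inr c) := by
    intro r c
    rw [Matrix.mul_apply, ← e.sum_comp, Fintype.sum_sum_type, Fin.sum_univ_two]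
    congr 1
    simp only [Y, of_apply, e2]
    fin_cases c <;> simp [M]
  let X : Matrix (Fin m) (Fin 2) ℤ[T;T⁻¹] := of fun k c => Y (e (.inl k)) c
  have hX : M.toBlocks₁₁ * X + M.toBlocks₁₂ = 0 := by
    ext1 k c
    rw [Matrix.zero_apply, ← hrow2 k c, hsum, Matrix.add_apply, Matrix.mul_apply]
    rfl
  have hX2 : M.toBlocks₂₁ * X + M.toBlocks₂₂ = of fun r c => (N * Y) (e (.inr r)) c := by
    ext1 k c
    rw [of_apply, hsum, Matrix.add_apply, Matrix.mul_apply]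
    rfl
  have hA : M.toBlocks₁₁.det = 1 := by
    have hent : ∀ k k', M.toBlocks₁₁ k k' = (if k = k' then 1 else 0) -
        a * if (k' : ℕ) = k + 1 then 1 else 0 := by
      intro k k'
      have : (twistMatrix (2 + m) * cyclic ℤ[T;T⁻¹] (2 + m)) (e (.inl k)) (e (.inl k')) =
          if (k' : ℕ) = k + 1 then 1 else 0 := by
        rw [Matrix.mul_apply]
        simp only [twistMatrix, of_apply, e1, show 2 + (k : ℕ) ≠ 0 by omega,
          show 2 + (k : ℕ) ≠ 1 by omega, if_false, ite_mul, one_mul, zero_mul, Finset.sum_ite_eq,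
          Finset.mem_univ, if_true, cyclic]
        congr 1
        have := k.isLt
        rcases Nat.lt_or_ge (2 + k + 1) (2 + m) with h | h
        · rw [Nat.mod_eq_of_lt h]; simp; omega
        · rw [show 2 + (k : ℕ) + 1 = 2 + m by omega, Nat.mod_self]; simp; omega
      simp only [toBlocks₁₁, of_apply, M, submatrix_apply, hN, Matrix.sub_apply, Matrix.smul_apply, this,
        Matrix.one_apply, EmbeddingLike.apply_eq_iff_eq, Sum.inl.injEq, smul_eq_mul]
    rw [det_of_isUpperTriangular]
    · simp [hent]
    · intro k k' h
      have h' : k' < k := h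
      rw [hent, if_neg h'.ne', if_neg (by have : (k' : ℕ) < k := h'; omega)]
      simp
  rw [← det_submatrix_equiv_self e, show N.submatrix e e = M from rfl, hblocks,
    det_fromBlocks_of_mul_add_eq_zero _ _ _ _ X hX, hA, one_mul, hX2, det_fin_two]
  simp only [of_apply, hrow0, hrow1, if_true, one_ne_zero, zero_ne_one, if_false]
  ring

end BraidWord

/-! ### Polynomials generating the same ideal of Laurent polynomials -/

theorem Polynomial.dvd_of_toLaurent_dvd_toLaurent {R : Type*} [CommRing R] [IsDomain R] {f g : R[X]}
    (hf : f.coeff 0 ≠ 0) (h : toLaurent f ∣ toLaurent g) : f ∣ g := by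
  obtain ⟨q, hq⟩ := h
  obtain ⟨n, q', hq'⟩ := LaurentPolynomial.exists_T_pow q
  have h1 : g * X ^ n = f * q' := by
    apply toLaurent_injective
    rw [map_mul, map_mul, hq, hq', toLaurent_X_pow, mul_assoc]
  have h2 : ¬ X ∣ f := by rwa [X_dvd_iff]
  obtain ⟨c, rfl⟩ : X ^ n ∣ q' :=
    prime_X.pow_dvd_of_dvd_mul_left n h2 (h1 ▸ dvd_mul_left _ _)
  refine ⟨c, mul_right_cancel₀ (pow_ne_zero n X_ne_zero) (h1.trans ?_)⟩
  ring

/-- The normalization in `BraidWord.IsAlexanderPolynomial` determines the polynomial. -/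
theorem Polynomial.span_toLaurent_eq_iff {f g : ℤ[X]} (hg : 0 < g.coeff 0) :
    (Ideal.span {toLaurent g} = Ideal.span {toLaurent f} ∧ (f ≠ 0 → 0 < f.coeff 0)) ↔ f = g := by
  constructor
  · rintro ⟨h, hf⟩
    have hf0 : f ≠ 0 := by
      rintro rfl
      have hg0 : g = 0 := by simpa [Ideal.span_singleton_eq_bot] using h
      simp [hg0] at hg
    have hf := hf hf0
    rw [Ideal.span_singleton_eq_span_singleton] at h
    have hfg : Associated f g := associated_of_dvd_dvd
      (dvd_of_toLaurent_dvd_toLaurent hf.ne' h.dvd')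
      (dvd_of_toLaurent_dvd_toLaurent hg.ne' h.dvd)
    obtain ⟨v, hv⟩ := hfg
    obtain ⟨c, hc, hcv⟩ := Polynomial.isUnit_iff.1 v.isUnit
    rw [← hcv] at hv
    rcases Int.isUnit_iff.1 hc with rfl | rfl
    · simpa using hv
    · rw [← hv] at hg
      simp at hg
      omega
  · rintro rfl
    exact ⟨rfl, fun _ => hg⟩

/-! ### The closed form -/

theorem Finset.sum_Icc_one_eq_sum_range {M : Type*} [AddCommMonoid M] (f : ℕ → M) (n : ℕ) :
    ∑ i ∈ Finset.Icc 1 n, f i = ∑ i ∈ Finset.range n, f (i + 1) := by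
  induction n with
  | zero => simp
  | succ n ih => rw [Finset.sum_Icc_succ_top (by omega), ih, Finset.sum_range_succ]

namespace BraidWord

/-- The closed form of the Alexander polynomial of `T(p, kp + 1; 2, 1)`. -/
noncomputable def alexanderPoly (p k : ℕ) : ℤ[X] :=
  if 3 ≤ p then
    1 + ∑ i ∈ Finset.Icc 1 k, (-X + X ^ p) * X ^ ((i - 1) * p)
      + ∑ i ∈ Finset.Icc 1 (p - 3), ∑ j ∈ Finset.Icc 1 k,
          (-X ^ (i * k * p + 1) + X ^ (i * k * p + 2) - X ^ (i * k * p + 2 + i)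
            + X ^ ((i * k + 1) * p)) * X ^ ((j - 1) * p)
      + ∑ i ∈ Finset.Icc 1 (k + 1),
          (-X ^ (k * p * (p - 2) + 1) + X ^ (k * p * (p - 2) + 2)) * X ^ ((i - 1) * p)
  else
    ∑ i ∈ Finset.range (2 * k + 3), (-1) ^ i * X ^ i

theorem alexanderPoly_mul (m k : ℕ) :
    alexanderPoly (2 + m) k * (1 - X ^ (2 + m)) * (1 - X ^ (k * (2 + m) + 1)) =
      (1 - X) * (1 - (X ^ (k * (2 + m) + 1)) ^ (2 + m) - (1 - X) * (X ^ (k * (2 + m) + 1)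
        + X * (X ^ (k * (2 + m) + 1)) ^ (1 + m)
        - (1 + X) * (X ^ (k * (2 + m) + 1)) ^ (2 + m))) := by
  -- All sums are geometric; `P = tᵖ` and `Q = t^(kp)`, so that `a = t Q`, and `tᵖ = P` is used to rewrite
  -- the powers of `a`.
  rcases m with _ | m
  · have h : (∑ i ∈ Finset.range (2 * k + 3), (-1) ^ i * X ^ i : ℤ[X]) * (1 + X)
        = 1 + X ^ (2 * k + 3) := by
      have h1 := geom_sum_mul_neg (-X : ℤ[X]) (2 * k + 3)
      have h2 : (-X : ℤ[X]) ^ (2 * k + 3) = -X ^ (2 * k + 3) := Odd.neg_pow ⟨k + 1, by ring⟩ _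
      rw [h2] at h1
      simp only [neg_pow (X : ℤ[X])] at h1
      linear_combination h1
    rw [alexanderPoly, if_neg (by norm_num)]
    linear_combination (1 - X) * (1 - X ^ (k * 2 + 1)) * h
  · rw [alexanderPoly, if_pos (by omega), show 2 + (m + 1) - 3 = m by omega,
      show 2 + (m + 1) - 2 = m + 1 by omega]
    simp only [Finset.sum_Icc_one_eq_sum_range, ← Finset.mul_sum, ← Finset.sum_mul,
      Nat.add_sub_cancel]
    set P : ℤ[X] := X ^ (2 + (m + 1)) with hP
    set Q : ℤ[X] := P ^ k with hQ
    have e0 : ∀ i : ℕ, (X : ℤ[X]) ^ (i * (2 + (m + 1))) = P ^ i := fun i => by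
      rw [hP, ← pow_mul, mul_comm]
    have hPQ : ∀ i : ℕ, (X : ℤ[X]) ^ (i * k * (2 + (m + 1))) = Q ^ i := fun i => by
      rw [e0, hQ, pow_mul']
    have hPQ' : ∀ i : ℕ, (X : ℤ[X]) ^ ((i * k + 1) * (2 + (m + 1))) = Q ^ i * P := fun i => by
      rw [e0, pow_succ, hQ, pow_mul']
    have e1 := geom_sum_mul_neg P k
    have e2 := geom_sum_mul_neg P (k + 1)
    have e3 := geom_sum_mul_neg Q m
    have e4 := geom_sum_mul_neg (X * Q) m
    have ha : (X : ℤ[X]) ^ (k * (2 + (m + 1)) + 1) = X * Q := by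
      rw [pow_succ, e0, mul_comm]
    have hb : (X : ℤ[X]) ^ (k * (2 + (m + 1)) * (m + 1)) = Q ^ (m + 1) := by
      rw [pow_mul, e0]
    have hsum : ∑ i ∈ Finset.range m, (-X ^ ((i + 1) * k * (2 + (m + 1)) + 1)
          + X ^ ((i + 1) * k * (2 + (m + 1)) + 2)
          - X ^ ((i + 1) * k * (2 + (m + 1)) + 2 + (i + 1))
          + X ^ (((i + 1) * k + 1) * (2 + (m + 1))) : ℤ[X])
        = (-X + X ^ 2 + P) * Q * ∑ i ∈ Finset.range m, Q ^ i
          - X ^ 2 * (X * Q) * ∑ i ∈ Finset.range m, (X * Q) ^ i := by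
      rw [Finset.mul_sum, Finset.mul_sum, ← Finset.sum_sub_distrib]
      refine Finset.sum_congr rfl fun i _ => ?_
      rw [hPQ', pow_add X (_ + 2), pow_add X _ 2, pow_succ X (_ * _), hPQ]
      ring
    have e5 : (X : ℤ[X]) ^ 3 * (X * Q) ^ m = P * Q ^ m := by
      rw [hP, mul_pow]; ring
    rw [hsum]
    simp only [e0, ha, pow_succ _ (k * (2 + (m + 1)) * (m + 1) + 1),
      pow_succ _ (k * (2 + (m + 1)) * (m + 1)), hb]
    rw [pow_succ, ← hQ] at e2
    rw [← hQ] at e1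
    set G := ∑ i ∈ Finset.range k, P ^ i
    set G' := ∑ i ∈ Finset.range (k + 1), P ^ i
    set H := ∑ i ∈ Finset.range m, Q ^ i
    set H' := ∑ i ∈ Finset.range m, (X * Q) ^ i
    have e6 : (X * Q) ^ (2 + (m + 1)) = P * Q ^ 3 * Q ^ m := by
      rw [mul_pow, ← hP]; ring
    have e7 : X * (X * Q) ^ (1 + (m + 1)) = P * Q ^ 2 * Q ^ m := by
      rw [hP, mul_pow]; ring
    rw [e6, e7]
    linear_combination (1 - X * Q) * ((P - X) + (-X + X ^ 2 + P) * Q * H - X ^ 2 * (X * Q) * H') * e1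
      + (1 - X * Q) * (-X + X ^ 2) * Q ^ (m + 1) * e2
      + (1 - X * Q) * (-X + X ^ 2 + P) * Q * e3
      - X ^ 2 * (X * Q) * (1 - Q) * e4 + (1 - Q) * Q * e5

theorem alexanderPoly_mul_geom_sum (m k : ℕ) :
    alexanderPoly (2 + m) k * (∑ i ∈ Finset.range (2 + m), X ^ i) * (1 - X ^ (k * (2 + m) + 1)) =
      1 - (X ^ (k * (2 + m) + 1)) ^ (2 + m) - (1 - X) * (X ^ (k * (2 + m) + 1)
        + X * (X ^ (k * (2 + m) + 1)) ^ (1 + m)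
        - (1 + X) * (X ^ (k * (2 + m) + 1)) ^ (2 + m)) := by
  have h0 : (1 - X : ℤ[X]) ≠ 0 := fun h => by simpa using congrArg (eval 0) h
  refine mul_left_cancel₀ h0 ?_
  rw [← alexanderPoly_mul, ← geom_sum_mul_neg X (2 + m)]
  ring

theorem alexanderPoly_coeff_zero (m k : ℕ) : (alexanderPoly (2 + m) k).coeff 0 = 1 := by
  have h := congrArg (eval 0) (alexanderPoly_mul_geom_sum m k)
  rw [coeff_zero_eq_eval_zero]
  simpa [eval_finsetSum, Finset.sum_range_succ', add_comm 2 m] using h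

/-! ### The Alexander polynomial -/

theorem elementaryIdeal_alexanderMatrix_eq_span_adjugate {n : ℕ} (w : BraidWord n) (s : Fin n)
    (hs : (s : ℕ) = 0) :
    elementaryIdeal w.alexanderMatrix 1 = Ideal.span
      {(w.alexanderMatrix.submatrix id w.relEquiv).adjugate (.inr s) (.inr s)} :=
  elementaryIdeal_one_eq_span_singleton w.alexanderMatrix w.relEquiv (u := w.leftKernel)
    (by simp [leftKernel, hs]) w.alexanderMatrix_mulVec_one w.leftKernel_vecMul

theorem det_burau_sub_one_add_vecMulVec {n : ℕ} (w : BraidWord n) (s : Fin n)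
    (hs : (s : ℕ) = 0) (y : Fin n → ℤ[T;T⁻¹]) :
    (burau w - 1 + Matrix.vecMulVec 1 y).det = (∑ i ∈ Finset.range n, T 1 ^ i) * (∑ i, y i) *
      (w.alexanderMatrix.submatrix id w.relEquiv).adjugate (.inr s) (.inr s) := by
  have hu : Matrix.vecMul w.leftKernel (w.alexanderMatrix.submatrix id w.relEquiv) = 0 := by
    ext1 j; exact congrFun w.leftKernel_vecMul (w.relEquiv j)
  rw [← det_alexanderMatrix_add, Matrix.det_add_vecMulVec_of_vecMul_eq_zero (r := .inr s)
    (by simp [leftKernel, hs]) w.alexanderMatrix_mulVec_one hu _ _ (.inr s)]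
  congr 2
  · simp [leftKernel, dotProduct, Finset.sum_range]
  · simp

theorem elementaryIdeal_twistedTorus (m k : ℕ) :
    elementaryIdeal (twistedTorus (2 + m) (k * (2 + m) + 1) 2 1 (by omega)).alexanderMatrix 1 =
      Ideal.span {toLaurent (alexanderPoly (2 + m) k)} := by
  set w := twistedTorus (2 + m) (k * (2 + m) + 1) 2 1 (by omega)
  let s : Fin (2 + m) := ⟨0, by omega⟩
  obtain ⟨y, hy, hsum⟩ := exists_burau_twistedTorus_eq (2 + m) k (by omega)
  have h := det_burau_sub_one_add_vecMulVec w s rfl (-y)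
  set d := (w.alexanderMatrix.submatrix id w.relEquiv).adjugate (.inr s) (.inr s) with hd
  set a : ℤ[T;T⁻¹] := T 1 ^ (k * (2 + m) + 1) with ha
  have h1 : burau w - 1 + Matrix.vecMulVec 1 (-y) =
      -(1 - a • (twistMatrix (2 + m) * Matrix.cyclic ℤ[T;T⁻¹] (2 + m))) := by
    rw [hy, Matrix.vecMulVec_neg]; abel
  have hF := congrArg toLaurent (alexanderPoly_mul_geom_sum m k)
  simp only [map_mul, map_sub, map_add, map_one, map_pow, map_sum, toLaurent_X, ← ha] at hF
  simp only [Pi.neg_apply, Finset.sum_neg_distrib, hsum] at h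
  rw [h1, Matrix.det_neg, det_one_sub_smul_twistMatrix_mul_cyclic, ← hF, Fintype.card_fin] at h
  have hne : (∑ i ∈ Finset.range (2 + m), (T 1 : ℤ[T;T⁻¹]) ^ i) * (1 - a) ≠ 0 := by
    have h0 : (∑ i ∈ Finset.range (2 + m), (X : ℤ[X]) ^ i) * (1 - X ^ (k * (2 + m) + 1)) ≠ 0 := by
      intro h0
      simpa [eval_finsetSum, Finset.sum_range_succ', add_comm 2 m] using congrArg (eval 0) h0
    have h2 := Polynomial.toLaurent_ne_zero.2 h0
    simpa only [map_mul, map_sub, map_one, map_pow, map_sum, toLaurent_X] using h2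
  have hd' : d = -(-1) ^ (2 + m) * toLaurent (alexanderPoly (2 + m) k) := by
    refine mul_left_cancel₀ hne ?_
    linear_combination h
  rw [elementaryIdeal_alexanderMatrix_eq_span_adjugate w s rfl, ← hd, hd',
    Ideal.span_singleton_mul_left_unit (isUnit_one.neg.pow (2 + m)).neg]

end BraidWord

/-- The Alexander polynomial of the twisted torus knot `T(p, kp + 1; 2, 1)`. -/
theorem lemma2p2 (p k : ℕ) (hp : 2 ≤ p) (hk : 1 ≤ k) (Δ : ℤ[X]) :
    (BraidWord.twistedTorus p (k * p + 1) 2 1 hp).IsAlexanderPolynomial Δ ↔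
      Δ =
        if 3 ≤ p then
          1 + ∑ i ∈ Finset.Icc 1 k, (-X + X ^ p) * X ^ ((i - 1) * p)
            + ∑ i ∈ Finset.Icc 1 (p - 3), ∑ j ∈ Finset.Icc 1 k,
                (-X ^ (i * k * p + 1) + X ^ (i * k * p + 2) - X ^ (i * k * p + 2 + i)
                  + X ^ ((i * k + 1) * p)) * X ^ ((j - 1) * p)
            + ∑ i ∈ Finset.Icc 1 (k + 1),
                (-X ^ (k * p * (p - 2) + 1) + X ^ (k * p * (p - 2) + 2)) * X ^ ((i - 1) * p)
        else
          ∑ i ∈ Finset.range (2 * k + 3), (-1) ^ i * X ^ i := by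
  obtain ⟨m, rfl⟩ := Nat.exists_eq_add_of_le hp
  rw [BraidWord.IsAlexanderPolynomial, BraidWord.elementaryIdeal_twistedTorus m k]
  exact Polynomial.span_toLaurent_eq_iff (by rw [BraidWord.alexanderPoly_coeff_zero]; norm_num)
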